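/- An arch system of size $n$ is a non-crossing perfect matching of $2n$ points on a line, drawn as $n$ arches above the line; for $n=0$ it is the empty arch system. Write $AB$ for the concatenation of arch systems $A$ and $B$ ($B$ is drawn to the right of $A$), and $\frown(A)$ for the arch system obtained by adding a single arch outside all of $A$. An atom is a non-empty arch system that is not the concatenation of two non-empty arch systems. An arch system $X$ contains $A$ if $A$ can be obtained from $X$ by deleting some (possibly no) arches; otherwise $X$ avoids $A$, and $\mathrm{Av}(A)$ denotes the set of all arch systems that avoid $A$. Let $\sim$ be the finest equivalence relation on arch systems such that 1. $A\sim B$ implies $\frown(A)\sim\;\frown(B)$; 2. $a\sim b$ implies $PaQ\sim PbQ$; 3. $PabQ\sim PbaQ$; 4. $a\frown(bc)\;\sim\;\frown(ab)\,c$; where $A,B,P,Q$ denote arbitrary arch systems and each of $a,b,c$ denotes an arbitrary atom or the empty arch system. **Theorem.** If $A$ and $B$ are arch systems with $A\sim B$, then $\mathrm{Av}(A)$ and $\mathrm{Av}(B)$ are Wilf-equivalent: there is a size-preserving bijection between $\mathrm{Av}(A)$ and $\mathrm{Av}(B)$; equivalently, the generating functions of $\mathrm{Av}(A)$ and $\mathrm{Av}(B)$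 according to the number of arches are equal. -/

import Mathlib

/-- An arch system (non-crossing perfect matching): a finite set of `n` arches drawn above a
baseline, joining in pairs the `2 n` points `0, 1, …, 2 n - 1`, without crossings. An arch is
recorded as the pair `(left end, right end)`. -/
@[ext]
structure ArchSystem where
  arches : Finset (ℕ × ℕ)
  left_lt_right : ∀ a ∈ arches, a.1 < a.2
  right_lt : ∀ a ∈ arches, a.2 < 2 * arches.card
  existsUnique_arch : ∀ p < 2 * arches.card, ∃! a, a ∈ arches ∧ (p = a.1 ∨ p = a.2)
  noncrossing : ∀ a ∈ arches, ∀ b ∈ arches, ¬ (a.1 < b.1 ∧ b.1 < a.2 ∧ a.2 < b.2)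

namespace ArchSystem

/-- The size of an arch system is its number of arches. -/
def size (X : ArchSystem) : ℕ := X.arches.card

/-- The empty arch system. -/
def empty : ArchSystem where
  arches := ∅
  left_lt_right := by simp
  right_lt := by simp
  existsUnique_arch := by simp
  noncrossing := by simp

/-- Moving an arch `k` units to the right. -/
def shiftArch (k : ℕ) : ℕ × ℕ ↪ ℕ × ℕ where
  toFun a := (a.1 + k, a.2 + k)
  inj' := by
    rintro ⟨x, y⟩ ⟨x', y'⟩ h
    simp only [Prod.mk.injEq] at h ⊢
    omega

/-- The set of arches of `X`, moved `k` units to the right. -/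
def shifted (X : ArchSystem) (k : ℕ) : Finset (ℕ × ℕ) := X.arches.map (shiftArch k)

theorem mem_shifted {X : ArchSystem} {k : ℕ} {a : ℕ × ℕ} :
    a ∈ X.shifted k ↔ ∃ b ∈ X.arches, a = (b.1 + k, b.2 + k) := by
  simp only [shifted, Finset.mem_map, shiftArch, Function.Embedding.coeFn_mk]
  constructor <;> rintro ⟨b, hb, h⟩ <;> exact ⟨b, hb, h.symm⟩

theorem card_concat (A B : ArchSystem) :
    (A.arches ∪ B.shifted (2 * A.size)).card = A.size + B.size := by
  rw [Finset.card_union_of_disjoint]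
  · simp [shifted, size]
  · rw [Finset.disjoint_left]
    intro a ha hb
    obtain ⟨b, -, rfl⟩ := mem_shifted.1 hb
    have := A.right_lt _ ha
    simp only [size] at this
    omega

/-- The concatenation `A B`: the system `B` is drawn to the right of `A`. -/
def concat (A B : ArchSystem) : ArchSystem where
  arches := A.arches ∪ B.shifted (2 * A.size)
  left_lt_right := by
    intro a ha
    rcases Finset.mem_union.1 ha with ha | ha
    · exact A.left_lt_right a ha
    · obtain ⟨b, hb, rfl⟩ := mem_shifted.1 ha
      have := B.left_lt_right b hb
      simpa using this
  right_lt := by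
    intro a ha
    rw [card_concat]
    rcases Finset.mem_union.1 ha with ha | ha
    · have := A.right_lt a ha
      simp only [size]
      omega
    · obtain ⟨b, hb, rfl⟩ := mem_shifted.1 ha
      have := B.right_lt b hb
      simp only [size]
      omega
  existsUnique_arch := by
    intro p hp
    rw [card_concat] at hp
    by_cases h : p < 2 * A.size
    · obtain ⟨a, ⟨ha, hpa⟩, hu⟩ := A.existsUnique_arch p h
      refine ⟨a, ⟨Finset.mem_union_left _ ha, hpa⟩, ?_⟩
      rintro a' ⟨ha', hpa'⟩
      rcases Finset.mem_union.1 ha' with ha' | ha'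
      · exact hu a' ⟨ha', hpa'⟩
      · obtain ⟨b, -, rfl⟩ := mem_shifted.1 ha'
        simp only at hpa'
        omega
    · obtain ⟨b, ⟨hb, hpb⟩, hu⟩ := B.existsUnique_arch (p - 2 * A.size)
        (by simp only [size] at *; omega)
      refine ⟨(b.1 + 2 * A.size, b.2 + 2 * A.size),
        ⟨Finset.mem_union_right _ (mem_shifted.2 ⟨b, hb, rfl⟩), by simp only; omega⟩, ?_⟩
      rintro a' ⟨ha', hpa'⟩
      rcases Finset.mem_union.1 ha' with ha' | ha'
      · have h1 := A.right_lt a' ha'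
        have h2 := A.left_lt_right a' ha'
        simp only [size] at h
        omega
      · obtain ⟨b', hb', rfl⟩ := mem_shifted.1 ha'
        simp only at hpa'
        rw [hu b' ⟨hb', by omega⟩]
  noncrossing := by
    intro a ha b hb
    rcases Finset.mem_union.1 ha with ha | ha <;> rcases Finset.mem_union.1 hb with hb | hb
    · exact A.noncrossing a ha b hb
    · obtain ⟨b', hb', rfl⟩ := mem_shifted.1 hb
      have := A.right_lt a ha
      simp only [size]
      omega
    · obtain ⟨a', ha', rfl⟩ := mem_shifted.1 ha
      have h1 := A.right_lt b hb
      have h2 := A.left_lt_right b hb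
      simp only [size]
      omega
    · obtain ⟨a', ha', rfl⟩ := mem_shifted.1 ha
      obtain ⟨b', hb', rfl⟩ := mem_shifted.1 hb
      have := B.noncrossing a' ha' b' hb'
      simp only
      omega

instance : Append ArchSystem := ⟨concat⟩

theorem card_archOver (A : ArchSystem) :
    (insert (0, 2 * A.size + 1) (A.shifted 1)).card = A.size + 1 := by
  rw [Finset.card_insert_of_notMem]
  · simp [shifted, size]
  · intro h
    obtain ⟨b, -, hb⟩ := mem_shifted.1 h
    simp only [Prod.mk.injEq] at hb
    omega

/-- The system obtained from `A` by adding a single arch outside all of `A`. -/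
def archOver (A : ArchSystem) : ArchSystem where
  arches := insert (0, 2 * A.size + 1) (A.shifted 1)
  left_lt_right := by
    intro a ha
    rcases Finset.mem_insert.1 ha with rfl | ha
    · simp
    · obtain ⟨b, hb, rfl⟩ := mem_shifted.1 ha
      have := A.left_lt_right b hb
      simpa using this
  right_lt := by
    intro a ha
    rw [card_archOver]
    rcases Finset.mem_insert.1 ha with rfl | ha
    · simp only
      omega
    · obtain ⟨b, hb, rfl⟩ := mem_shifted.1 ha
      have := A.right_lt b hb
      simp only [size]
      omega
  existsUnique_arch := by
    intro p hp
    rw [card_archOver] at hp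
    by_cases h : p = 0 ∨ p = 2 * A.size + 1
    · refine ⟨(0, 2 * A.size + 1), ⟨Finset.mem_insert_self _ _, h⟩, ?_⟩
      rintro a ⟨ha, hpa⟩
      rcases Finset.mem_insert.1 ha with rfl | ha
      · rfl
      · obtain ⟨b, hb, rfl⟩ := mem_shifted.1 ha
        have h1 := A.right_lt b hb
        have h2 := A.left_lt_right b hb
        simp only [size] at *
        omega
    · obtain ⟨b, ⟨hb, hpb⟩, hu⟩ := A.existsUnique_arch (p - 1)
        (by simp only [size] at *; omega)
      refine ⟨(b.1 + 1, b.2 + 1),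
        ⟨Finset.mem_insert_of_mem (mem_shifted.2 ⟨b, hb, rfl⟩), by simp only; omega⟩, ?_⟩
      rintro a ⟨ha, hpa⟩
      rcases Finset.mem_insert.1 ha with rfl | ha
      · exact absurd hpa h
      · obtain ⟨b', hb', rfl⟩ := mem_shifted.1 ha
        simp only at hpa
        rw [hu b' ⟨hb', by omega⟩]
  noncrossing := by
    intro a ha b hb
    rcases Finset.mem_insert.1 ha with rfl | ha <;> rcases Finset.mem_insert.1 hb with rfl | hb
    · simp
    · obtain ⟨b', hb', rfl⟩ := mem_shifted.1 hb
      have := A.right_lt b' hb'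
      simp only [size]
      omega
    · simp
    · obtain ⟨a', ha', rfl⟩ := mem_shifted.1 ha
      obtain ⟨b', hb', rfl⟩ := mem_shifted.1 hb
      have := A.noncrossing a' ha' b' hb'
      simp only
      omega

/-- An atom is a non-empty arch system that is not the concatenation of two non-empty ones. -/
def IsAtomic (X : ArchSystem) : Prop :=
  X ≠ empty ∧ ∀ Y Z : ArchSystem, X = Y ++ Z → Y = empty ∨ Z = empty

/-- An atom or the empty arch system. -/
def IsAtomicOrEmpty (X : ArchSystem) : Prop := X.IsAtomic ∨ X = empty

/-- `P` is a subsystem of `X` if it is obtained from `X` by deleting some arches (and closing up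
the baseline), i.e. if some order-preserving relabelling of the points sends every arch of `P`
to an arch of `X`. -/
def IsSubsystem (P X : ArchSystem) : Prop :=
  ∃ f : ℕ → ℕ, StrictMono f ∧ ∀ a ∈ P.arches, (f a.1, f a.2) ∈ X.arches

/-- The class of the arch systems that avoid `A`. -/
def Av (A : ArchSystem) : Set ArchSystem := {X | ¬ IsSubsystem A X}

/-- Wilf-equivalence of two classes: a size-preserving bijection between them. -/
def WilfEquivalent (S T : Set ArchSystem) : Prop :=
  ∃ e : S ≃ T, ∀ X : S, (e X).1.size = X.1.size

/-- There are finitely many arch systems of each size, so that counting them is meaningful. -/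
theorem finite_size_eq (n : ℕ) : {X : ArchSystem | X.size = n}.Finite := by
  refine Set.Finite.of_finite_image (f := arches) ?_ (fun X _ Y _ h => ArchSystem.ext h)
  refine Set.Finite.subset
    (Finset.finite_toSet (Finset.range (2 * n) ×ˢ Finset.range (2 * n)).powerset) ?_
  rintro _ ⟨X, hX, rfl⟩
  simp only [Finset.coe_powerset, Set.mem_preimage, Set.mem_powerset_iff, Finset.coe_subset]
  intro a ha
  have h1 := X.left_lt_right a ha
  have h2 := X.right_lt a ha
  have h3 : X.arches.card = n := hX
  simp only [Finset.mem_product, Finset.mem_range]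
  omega

/-- The generating function of a class, according to the number of arches. -/
noncomputable def genFun (S : Set ArchSystem) : PowerSeries ℤ :=
  PowerSeries.mk fun n => (({X ∈ S | X.size = n}.ncard : ℕ) : ℤ)

/-- The finest equivalence relation on arch systems closed under the four rules
`archOver`, `substitute`, `commute` and `rotate`. -/
inductive Sim : ArchSystem → ArchSystem → Prop
  | refl (A : ArchSystem) : Sim A A
  | symm {A B : ArchSystem} : Sim A B → Sim B A
  | trans {A B C : ArchSystem} : Sim A B → Sim B C → Sim A C
  | archOver {A B : ArchSystem} : Sim A B → Sim A.archOver B.archOver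
  | substitute {a b : ArchSystem} (P Q : ArchSystem) :
      a.IsAtomicOrEmpty → b.IsAtomicOrEmpty → Sim a b → Sim (P ++ a ++ Q) (P ++ b ++ Q)
  | commute {a b : ArchSystem} (P Q : ArchSystem) :
      a.IsAtomicOrEmpty → b.IsAtomicOrEmpty → Sim (P ++ a ++ b ++ Q) (P ++ b ++ a ++ Q)
  | rotate {a b c : ArchSystem} :
      a.IsAtomicOrEmpty → b.IsAtomicOrEmpty → c.IsAtomicOrEmpty →
      Sim (a ++ (b ++ c).archOver) ((a ++ b).archOver ++ c)

end ArchSystem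

/-! Reading arches as vertices turns arch systems into plane forests, and deletion of arches into
deletion of vertices whose children move up; an atom is a single tree. It is enough to show that
related patterns have equal avoidance series. Let A_P be the series of `P`. A forest avoids `tree p`
exactly when the subtrees of each root avoid `p`, so A_(tree p) = 1 / (1 - x A_p) (`avoidGF_tree`).
A case split on whether the first tree contains `p` below its root gives a rational expression in
A_p and A_q for the pattern of two trees (`avoidGF_two`). These formulas settle the outer arch rule
and the rotation rule: the two sides of the latter are composites of them that agree as rational
functions.

The substitution and commutation rules place patterns in a context, where these formulas no longer
suffice. They go through a stronger relation, `Equidistributed`, whose bijection also preserves the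
number of trees. It passes to contexts: to put a tree in front of both patterns, change only what
follows the earliest occurrence of that tree (`mapAfter`). The search may open a root, and the
number of trees tells where to close it again. Mirror images handle contexts on the right. Trees
with equal series are equidistributed by acting below each root (`equidistributed_tree`), and
adjacent trees are exchanged by an explicit involution (`swapTwo`). -/

/-! ### Plane forests -/

/-- Plane forests: `cons L R` has a first tree, whose root has the forest `L` of subtrees,
followed by the forest `R`. -/
inductive Forest : Type
  | nil : Forest
  | cons : Forest → Forest → Forest

namespace Forest

/-- The number of vertices. -/
def size : Forest → ℕ
  | nil => 0
  | cons L R => L.size + R.size + 1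

/-- The number of trees. -/
def length : Forest → ℕ
  | nil => 0
  | cons _ R => R.length + 1

/-- Concatenation of forests. -/
def append : Forest → Forest → Forest
  | nil, Y => Y
  | cons L R, Y => cons L (append R Y)

instance : Append Forest := ⟨append⟩

/-- The forest of the first `m` trees. -/
def take : ℕ → Forest → Forest
  | 0, _ => nil
  | _ + 1, nil => nil
  | m + 1, cons L R => cons L (take m R)

/-- The forest left when the first `m` trees are removed. -/
def drop : ℕ → Forest → Forest
  | 0, X => X
  | _ + 1, nil => nil
  | m + 1, cons _ R => drop m R

/-- The mirror image. -/
def reverse : Forest → Forest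
  | nil => nil
  | cons L R => R.reverse ++ cons L.reverse nil

@[simp] theorem size_nil : nil.size = 0 := rfl
@[simp] theorem size_cons (L R : Forest) : (cons L R).size = L.size + R.size + 1 := rfl
@[simp] theorem length_nil : nil.length = 0 := rfl
@[simp] theorem length_cons (L R : Forest) : (cons L R).length = R.length + 1 := rfl
@[simp] theorem nil_append (Y : Forest) : nil ++ Y = Y := rfl
@[simp] theorem cons_append (L R Y : Forest) : cons L R ++ Y = cons L (R ++ Y) := rfl
@[simp] theorem take_zero (X : Forest) : take 0 X = nil := by cases X <;> rfl
@[simp] theorem take_nil (m : ℕ) : take m nil = nil := by cases m <;> rfl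
@[simp] theorem take_succ_cons (m : ℕ) (L R : Forest) :
    take (m + 1) (cons L R) = cons L (take m R) := rfl
@[simp] theorem drop_zero (X : Forest) : drop 0 X = X := by cases X <;> rfl
@[simp] theorem drop_nil (m : ℕ) : drop m nil = nil := by cases m <;> rfl
@[simp] theorem drop_succ_cons (m : ℕ) (L R : Forest) :
    drop (m + 1) (cons L R) = drop m R := rfl
@[simp] theorem reverse_nil : nil.reverse = nil := rfl
@[simp] theorem reverse_cons (L R : Forest) :
    (cons L R).reverse = R.reverse ++ cons L.reverse nil := rfl

@[simp] theorem append_nil (X : Forest) : X ++ nil = X := by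
  induction X with
  | nil => rfl
  | cons L R _ ih => simp [ih]

theorem append_assoc (X Y Z : Forest) : X ++ Y ++ Z = X ++ (Y ++ Z) := by
  induction X with
  | nil => rfl
  | cons L R _ ih => simp [ih]

@[simp] theorem size_append (X Y : Forest) : (X ++ Y).size = X.size + Y.size := by
  induction X with
  | nil => simp
  | cons L R _ ih => simp [ih]; omega

@[simp] theorem length_append (X Y : Forest) : (X ++ Y).length = X.length + Y.length := by
  induction X with
  | nil => simp
  | cons L R _ ih => simp [ih]; omega

@[simp] theorem take_append_drop (m : ℕ) (X : Forest) : take m X ++ drop m X = X := by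
  induction X generalizing m with
  | nil => simp
  | cons L R _ ih => cases m <;> simp [ih]

theorem length_take (m : ℕ) (X : Forest) : (take m X).length = min m X.length := by
  induction X generalizing m with
  | nil => simp
  | cons L R _ ih => cases m <;> simp [ih]

@[simp] theorem take_length_append (X Y : Forest) : take X.length (X ++ Y) = X := by
  induction X with
  | nil => simp
  | cons L R _ ih => simp [ih]

@[simp] theorem drop_length_append (X Y : Forest) : drop X.length (X ++ Y) = Y := by
  induction X with
  | nil => simp
  | cons L R _ ih => simp [ih]

@[simp] theorem reverse_append (X Y : Forest) :
    (X ++ Y).reverse = Y.reverse ++ X.reverse := by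
  induction X with
  | nil => simp
  | cons L R _ ih => simp [ih, append_assoc]

@[simp] theorem reverse_reverse (X : Forest) : X.reverse.reverse = X := by
  induction X with
  | nil => rfl
  | cons L R ihL ihR => simp [ihL, ihR]

@[simp] theorem size_reverse (X : Forest) : X.reverse.size = X.size := by
  induction X with
  | nil => rfl
  | cons L R ihL ihR => simp [ihL, ihR]; omega

@[simp] theorem length_reverse (X : Forest) : X.reverse.length = X.length := by
  induction X with
  | nil => rfl
  | cons L R ihL ihR => simp [ihR]

/-! ### Containment of forests -/

/-- `Contains X P` says that `P` is obtained from `X` by deleting vertices, where the children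
of a deleted vertex take its place. -/
inductive Contains : Forest → Forest → Prop
  | base (X : Forest) : Contains X nil
  | keep {L R p q : Forest} : Contains L p → Contains R q → Contains (cons L R) (cons p q)
  | delete {L R P : Forest} : Contains (L ++ R) P → Contains (cons L R) P

theorem Contains.append {X Y P Q : Forest} (hP : Contains X P) (hQ : Contains Y Q) :
    Contains (X ++ Y) (P ++ Q) := by
  induction hP with
  | base X =>
    rw [nil_append]
    -- All of `X` is deleted, root by root. `L ++ R` is not a subterm of `cons L R`, hence the
    -- induction on size.
    induction h : X.size using Nat.strong_induction_on generalizing X with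
    | _ n ih =>
      cases X with
      | nil => exact hQ
      | cons L R =>
        rw [cons_append]
        refine .delete ?_
        rw [← append_assoc]
        exact ih _ (by simp at h ⊢; omega) _ rfl
  | keep h _ _ ih => exact .keep h ih
  | delete _ ih =>
    rw [cons_append]
    refine .delete ?_
    rwa [← append_assoc]

@[simp] theorem contains_nil (X : Forest) : Contains X nil := .base X

@[simp] theorem not_nil_contains_cons (p q : Forest) : ¬ Contains nil (cons p q) := nofun

theorem contains_cons_cons {L R p q : Forest} :
    Contains (cons L R) (cons p q) ↔ Contains L p ∧ Contains R q ∨ Contains (L ++ R) (cons p q) := by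
  constructor
  · rintro (_ | ⟨h, h'⟩ | h)
    exacts [.inl ⟨h, h'⟩, .inr h]
  · rintro (⟨h, h'⟩ | h)
    exacts [.keep h h', .delete h]

theorem Contains.append_left {Y P : Forest} (X : Forest) (h : Contains Y P) :
    Contains (X ++ Y) P := by
  simpa using (Contains.base X).append h

theorem Contains.append_right {X P : Forest} (Y : Forest) (h : Contains X P) :
    Contains (X ++ Y) P := by
  simpa using h.append (Contains.base Y)

/-- No tree of the pattern straddles the two sides, because its root comes from a vertex of one side
and its descendants from below that vertex. -/
theorem Contains.exists_split {X Y P : Forest} (h : Contains (X ++ Y) P) :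
    ∃ P₁ P₂, P = P₁ ++ P₂ ∧ Contains X P₁ ∧ Contains Y P₂ := by
  induction hn : X.size + P.size using Nat.strong_induction_on generalizing X P with
  | _ n ih =>
    cases X with
    | nil => exact ⟨nil, P, rfl, .base _, h⟩
    | cons L R =>
      cases P with
      | nil => exact ⟨nil, nil, rfl, .base _, .base _⟩
      | cons p q =>
        rw [cons_append, contains_cons_cons, ← append_assoc] at h
        rcases h with ⟨h, h'⟩ | h
        · obtain ⟨P₁, P₂, rfl, h₁, h₂⟩ := ih _ (by simp at hn ⊢; omega) h' rfl
          exact ⟨cons p P₁, P₂, rfl, .keep h h₁, h₂⟩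
        · obtain ⟨P₁, P₂, e, h₁, h₂⟩ := ih _ (by simp at hn ⊢; omega) h rfl
          exact ⟨P₁, P₂, e, .delete h₁, h₂⟩

theorem Contains.reverse {X P : Forest} (h : Contains X P) :
    Contains X.reverse P.reverse := by
  induction h with
  | base => simp
  | keep _ _ ih ih' => exact ih'.append (.keep ih (.base _))
  | delete _ ih =>
    rw [reverse_append] at ih
    obtain ⟨P₁, P₂, e, h₁, h₂⟩ := ih.exists_split
    rw [e]
    exact h₁.append (.delete (by simpa using h₂))

theorem contains_reverse {X P : Forest} :
    Contains X.reverse P.reverse ↔ Contains X P :=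
  ⟨fun h => by simpa using h.reverse, .reverse⟩

theorem Contains.tail {X p q : Forest} (h : Contains X (cons p q)) : Contains X q := by
  induction hn : X.size using Nat.strong_induction_on generalizing X with
  | _ n ih =>
    cases X with
    | nil => simp at h
    | cons L R =>
      rcases contains_cons_cons.1 h with ⟨_, h⟩ | h
      · exact .delete (h.append_left L)
      · exact .delete (ih _ (by simp at hn ⊢; omega) h rfl)

/-- The forest with one tree, whose root has the forest `p` of subtrees. -/
abbrev tree (p : Forest) : Forest := cons p nil

theorem Contains.head {X p q : Forest} (h : Contains X (cons p q)) :
    Contains X (tree p) := by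
  induction hn : X.size using Nat.strong_induction_on generalizing X with
  | _ n ih =>
    cases X with
    | nil => simp at h
    | cons L R =>
      rcases contains_cons_cons.1 h with ⟨h, _⟩ | h
      · exact .keep h (.base _)
      · exact .delete (ih _ (by simp at hn ⊢; omega) h rfl)

theorem append_eq_cons {P Q p q : Forest} :
    P ++ Q = cons p q ↔ P = nil ∧ Q = cons p q ∨ ∃ P', P = cons p P' ∧ P' ++ Q = q := by
  cases P <;> simp

theorem contains_append_tree {X Y p : Forest} :
    Contains (X ++ Y) (tree p) ↔ Contains X (tree p) ∨ Contains Y (tree p) := by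
  constructor
  · intro h
    obtain ⟨P₁, P₂, e, h₁, h₂⟩ := h.exists_split
    rcases append_eq_cons.1 e.symm with ⟨rfl, rfl⟩ | ⟨P', rfl, _⟩
    exacts [.inr h₂, .inl h₁.head]
  · rintro (h | h)
    exacts [h.append_right Y, h.append_left X]

theorem contains_of_contains_tree {X p : Forest} (h : Contains X (tree p)) : Contains X p := by
  induction hn : X.size using Nat.strong_induction_on generalizing X with
  | _ n ih =>
    cases X with
    | nil => simp at h
    | cons L R =>
      rcases contains_cons_cons.1 h with ⟨h, _⟩ | h
      · exact .delete (h.append_right R)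
      · exact .delete (ih _ (by simp at hn ⊢; omega) h rfl)

/-- Finding `tree p` strictly below the first root gives nothing new, since `L` then contains `p`
already. -/
theorem contains_cons_tree {L R p : Forest} :
    Contains (cons L R) (tree p) ↔ Contains L p ∨ Contains R (tree p) := by
  rw [contains_cons_cons, contains_append_tree]
  have := @contains_of_contains_tree L p
  simp only [contains_nil, and_true]
  tauto

theorem contains_append_two {X Y p q : Forest} :
    Contains (X ++ Y) (cons p (tree q)) ↔ Contains X (cons p (tree q)) ∨
      Contains X (tree p) ∧ Contains Y (tree q) ∨ Contains Y (cons p (tree q)) := by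
  constructor
  · intro h
    obtain ⟨P₁, P₂, e, h₁, h₂⟩ := h.exists_split
    rcases append_eq_cons.1 e.symm with ⟨rfl, rfl⟩ | ⟨P', rfl, e'⟩
    · exact .inr (.inr h₂)
    · rcases append_eq_cons.1 e' with ⟨rfl, rfl⟩ | ⟨P', rfl, e'⟩
      · exact .inr (.inl ⟨h₁, h₂⟩)
      · cases P' with
        | nil => exact .inl h₁
        | cons => simp at e'
  · rintro (h | ⟨h, h'⟩ | h)
    exacts [h.append_right Y, h.append h', h.append_left X]

/-- If the only root were kept for `p`, no vertex would be left for the second tree. -/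
theorem tree_contains_two {L p q : Forest} :
    Contains (tree L) (cons p (tree q)) ↔ Contains L (cons p (tree q)) := by
  simp [contains_cons_cons]

theorem contains_cons_two {L R p q : Forest} :
    Contains (cons L R) (cons p (tree q)) ↔ Contains L (cons p (tree q)) ∨
      Contains L p ∧ Contains R (tree q) ∨ Contains R (cons p (tree q)) := by
  have h := @contains_append_two (tree L) R p q
  rwa [tree_contains_two, contains_cons_tree, cons_append, nil_append,
    or_iff_left (not_nil_contains_cons _ _)] at h

/-! ### Equidistribution -/

/-- `P` and `Q` are equidistributed if some bijection that preserves the number of vertices and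
the number of trees turns the forests that contain `P` into those that contain `Q`. -/
def Equidistributed (P Q : Forest) : Prop :=
  ∃ e : Forest ≃ Forest, ∀ X, (e X).size = X.size ∧ (e X).length = X.length ∧
    (Contains (e X) Q ↔ Contains X P)

theorem Equidistributed.reverse {P Q : Forest} :
    Equidistributed P Q → Equidistributed P.reverse Q.reverse := by
  rintro ⟨e, he⟩
  let r : Forest ≃ Forest := ⟨Forest.reverse, Forest.reverse, reverse_reverse, reverse_reverse⟩
  refine ⟨r.trans (e.trans r), fun X => ⟨?_, ?_, ?_⟩⟩
  · simp [r, (he _).1]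
  · simp [r, (he _).2.1]
  · simp only [r, Equiv.trans_apply, Equiv.coe_fn_mk, contains_reverse, (he _).2.2]
    rw [← contains_reverse, reverse_reverse]

/-! ### Equidistribution in a context -/

open Classical in
/-- The map on forests that applies `f` to what follows the first occurrence of `tree p`. -/
noncomputable def mapAfter (p : Forest) (f : Forest → Forest) : Forest → Forest
  | nil => nil
  | cons L R =>
    if Contains L (tree p) then
      cons (take L.length (mapAfter p f (L ++ R))) (drop L.length (mapAfter p f (L ++ R)))
    else if Contains L p then cons L (f R)
    else cons L (mapAfter p f R)
  termination_by X => X.size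
  decreasing_by all_goals simp; try omega

section mapAfter

variable {p : Forest} {f g : Forest → Forest}

theorem mapAfter_nil : mapAfter p f nil = nil := by rw [mapAfter]

theorem mapAfter_of_contains_tree {L : Forest} (R : Forest) (h : Contains L (tree p)) :
    mapAfter p f (cons L R) = cons (take L.length (mapAfter p f (L ++ R)))
      (drop L.length (mapAfter p f (L ++ R))) := by
  rw [mapAfter, if_pos h]

theorem mapAfter_of_contains {L : Forest} (R : Forest) (h : ¬ Contains L (tree p))
    (h' : Contains L p) : mapAfter p f (cons L R) = cons L (f R) := by
  rw [mapAfter, if_neg h, if_pos h']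

theorem mapAfter_of_not_contains {L : Forest} (R : Forest) (h : ¬ Contains L p) :
    mapAfter p f (cons L R) = cons L (mapAfter p f R) := by
  rw [mapAfter, if_neg (mt contains_of_contains_tree h), if_neg h]

/-- The statement on prefixes makes `mapAfter` reversible: for `m = L.length` it shows that the
forest put back under an opened root still contains `tree p`, so that the inverse takes the same
branch. -/
theorem mapAfter_spec (hf : ∀ X, (f X).size = X.size ∧ (f X).length = X.length) (X : Forest) :
    (mapAfter p f X).size = X.size ∧ (mapAfter p f X).length = X.length ∧
      ∀ m, Contains (take m (mapAfter p f X)) (tree p) ↔ Contains (take m X) (tree p) := by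
  induction hn : X.size using Nat.strong_induction_on generalizing X with
  | _ n ih =>
    subst hn
    cases X with
    | nil => simp [mapAfter_nil]
    | cons L R =>
      by_cases h : Contains L (tree p)
      · obtain ⟨h₁, h₂, h₃⟩ := ih _ (by simp) (L ++ R) rfl
        rw [mapAfter_of_contains_tree R h]
        set Z := mapAfter p f (L ++ R)
        have e := take_append_drop L.length Z
        have e₁ := congrArg size e
        have e₂ := congrArg length e
        have h₄ := h₃ L.length
        have e₃ := length_take L.length Z
        rw [take_length_append] at h₄
        simp only [size_append, length_append] at h₁ h₂ e₁ e₂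
        refine ⟨by simp only [size_cons]; omega, by simp only [length_cons]; omega, ?_⟩
        rintro (_ | m)
        · simp
        · simp only [take_succ_cons, contains_cons_tree, contains_of_contains_tree h,
            contains_of_contains_tree (h₄.2 h), true_or]
      · by_cases h' : Contains L p
        · rw [mapAfter_of_contains R h h']
          refine ⟨by simp [hf], by simp [hf], ?_⟩
          rintro (_ | m) <;> simp [contains_cons_tree, h']
        · obtain ⟨h₁, h₂, h₃⟩ := ih _ (by simp) R rfl
          rw [mapAfter_of_not_contains R h']
          refine ⟨by simp [h₁], by simp [h₂], ?_⟩
          rintro (_ | m) <;> simp [contains_cons_tree, h₃]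

theorem length_take_mapAfter (hf : ∀ X, (f X).size = X.size ∧ (f X).length = X.length)
    (L R : Forest) : (take L.length (mapAfter p f (L ++ R))).length = L.length := by
  simp [length_take, (mapAfter_spec hf _).2.1]

theorem contains_take_mapAfter (hf : ∀ X, (f X).size = X.size ∧ (f X).length = X.length)
    {L : Forest} (R : Forest) (h : Contains L (tree p)) :
    Contains (take L.length (mapAfter p f (L ++ R))) (tree p) := by
  rw [(mapAfter_spec hf _).2.2, take_length_append]
  exact h

theorem mapAfter_leftInverse (hf : ∀ X, (f X).size = X.size ∧ (f X).length = X.length)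
    (hgf : Function.LeftInverse g f) :
    Function.LeftInverse (mapAfter p g) (mapAfter p f) := by
  intro X
  induction hn : X.size using Nat.strong_induction_on generalizing X with
  | _ n ih =>
    subst hn
    cases X with
    | nil => simp [mapAfter_nil]
    | cons L R =>
      by_cases h : Contains L (tree p)
      -- Opening the root again undoes the cut after `L.length` trees.
      · rw [mapAfter_of_contains_tree R h,
          mapAfter_of_contains_tree _ (contains_take_mapAfter hf R h),
          take_append_drop, length_take_mapAfter hf, ih _ (by simp) (L ++ R) rfl]
        simp
      · by_cases h' : Contains L p
        · rw [mapAfter_of_contains R h h', mapAfter_of_contains _ h h', hgf]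
        · rw [mapAfter_of_not_contains R h', mapAfter_of_not_contains _ h',
            ih _ (by simp) R rfl]

/-- The root is not needed for `p`, as `L` supplies a full copy of `tree p`. This and the next two
lemmas match the three branches of `mapAfter`. -/
theorem contains_cons_of_contains_tree {L : Forest} (R P : Forest) (h : Contains L (tree p)) :
    Contains (cons L R) (cons p P) ↔ Contains (L ++ R) (cons p P) := by
  rw [contains_cons_cons, or_iff_right_of_imp]
  rintro ⟨_, h'⟩
  exact h.append h'

/-- The first tree holds `tree p` only by using its root, so nothing of it is left for `P`; if the
root is deleted, the pattern can place no tree in `L` at all. -/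
theorem contains_cons_of_contains {L : Forest} (R P : Forest) (h : ¬ Contains L (tree p))
    (h' : Contains L p) : Contains (cons L R) (cons p P) ↔ Contains R P := by
  refine ⟨fun H => ?_, .keep h'⟩
  rcases contains_cons_cons.1 H with ⟨_, H⟩ | H
  · exact H
  · obtain ⟨P₁, P₂, e, h₁, h₂⟩ := H.exists_split
    rcases append_eq_cons.1 e.symm with ⟨rfl, rfl⟩ | ⟨P', rfl, _⟩
    exacts [h₂.tail, absurd h₁.head h]

theorem contains_cons_of_not_contains {L : Forest} (R P : Forest) (h : ¬ Contains L p) :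
    Contains (cons L R) (cons p P) ↔ Contains R (cons p P) := by
  refine ⟨fun H => ?_, fun H => .delete (H.append_left L)⟩
  rcases contains_cons_cons.1 H with ⟨H, _⟩ | H
  · exact absurd H h
  · obtain ⟨P₁, P₂, e, h₁, h₂⟩ := H.exists_split
    rcases append_eq_cons.1 e.symm with ⟨rfl, rfl⟩ | ⟨P', rfl, _⟩
    exacts [h₂, absurd (contains_of_contains_tree h₁.head) h]

theorem mapAfter_contains (hf : ∀ X, (f X).size = X.size ∧ (f X).length = X.length)
    {P Q : Forest} (hPQ : ∀ X, Contains (f X) Q ↔ Contains X P) (X : Forest) :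
    Contains (mapAfter p f X) (cons p Q) ↔ Contains X (cons p P) := by
  induction hn : X.size using Nat.strong_induction_on generalizing X with
  | _ n ih =>
    subst hn
    cases X with
    | nil => simp [mapAfter_nil]
    | cons L R =>
      by_cases h : Contains L (tree p)
      · rw [mapAfter_of_contains_tree R h,
          contains_cons_of_contains_tree _ _ (contains_take_mapAfter hf R h),
          take_append_drop, ih _ (by simp) (L ++ R) rfl, contains_cons_of_contains_tree _ _ h]
      · by_cases h' : Contains L p
        · rw [mapAfter_of_contains R h h', contains_cons_of_contains _ _ h h',
            contains_cons_of_contains _ _ h h', hPQ]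
        · rw [mapAfter_of_not_contains R h', contains_cons_of_not_contains _ _ h',
            contains_cons_of_not_contains _ _ h', ih _ (by simp) R rfl]

end mapAfter

theorem Equidistributed.cons {P Q : Forest} (p : Forest) :
    Equidistributed P Q → Equidistributed (cons p P) (cons p Q) := by
  rintro ⟨e, he⟩
  have hf : ∀ X, (e X).size = X.size ∧ (e X).length = X.length := fun X => ⟨(he X).1, (he X).2.1⟩
  have hg : ∀ X, (e.symm X).size = X.size ∧ (e.symm X).length = X.length := fun X => by
    have := he (e.symm X)
    rw [e.apply_symm_apply] at this
    exact ⟨this.1.symm, this.2.1.symm⟩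
  exact ⟨⟨mapAfter p e, mapAfter p e.symm, mapAfter_leftInverse hf e.symm_apply_apply,
    mapAfter_leftInverse hg e.apply_symm_apply⟩, fun X => ⟨(mapAfter_spec hf X).1,
    (mapAfter_spec hf X).2.1, mapAfter_contains hf (fun X => (he X).2.2) X⟩⟩

theorem Equidistributed.append_left {P Q : Forest} (S : Forest) (h : Equidistributed P Q) :
    Equidistributed (S ++ P) (S ++ Q) := by
  induction S with
  | nil => exact h
  | cons p S _ ih => exact ih.cons p

/-- The mirror image turns a right context into a left one. -/
theorem Equidistributed.append_right {P Q : Forest} (S : Forest) (h : Equidistributed P Q) :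
    Equidistributed (P ++ S) (Q ++ S) := by
  simpa using (h.reverse.append_left S.reverse).reverse

/-! ### Exchanging two adjacent trees -/

open Classical in
/-- The reversal of the order of the trees, here and in those trees that contain both `p`
and `q`. -/
noncomputable def swapTwo (p q : Forest) : Forest → Forest
  | nil => nil
  | cons L R => swapTwo p q R ++
      tree (if Contains L (tree p) ∧ Contains L (tree q) then swapTwo p q L else L)

section swapTwo

variable (p q : Forest)

theorem swapTwo_append (X Y : Forest) : swapTwo p q (X ++ Y) = swapTwo p q Y ++ swapTwo p q X := by
  induction X with
  | nil => simp [swapTwo]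
  | cons L R _ ih => simp [swapTwo, ih, append_assoc]

/-- A subforest `L` that lacks `tree p` or `tree q` contains neither two-tree pattern and can be
left alone. In the other case `L` and its image both contain `p` and `q`, so mixed occurrences
depend only on the other trees. The test uses `tree p` and `tree q`, rather than `p` and `q`,
because their containment is what the induction preserves. -/
theorem swapTwo_spec (X : Forest) :
    (swapTwo p q X).size = X.size ∧ (swapTwo p q X).length = X.length ∧
    (Contains (swapTwo p q X) (tree p) ↔ Contains X (tree p)) ∧
    (Contains (swapTwo p q X) (tree q) ↔ Contains X (tree q)) ∧
    (Contains (swapTwo p q X) (cons q (tree p)) ↔ Contains X (cons p (tree q))) := by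
  induction X with
  | nil => simp [swapTwo]
  | cons L R ihL ihR =>
    obtain ⟨s₁, l₁, p₁, q₁, c₁⟩ := ihL
    obtain ⟨s₂, l₂, p₂, q₂, c₂⟩ := ihR
    rw [swapTwo]
    split_ifs with h
    · have hp := contains_of_contains_tree h.1
      have hp' := contains_of_contains_tree (p₁.2 h.1)
      refine ⟨?_, ?_, ?_, ?_, ?_⟩
      · simp [s₁, s₂]; omega
      · simp [l₂]
      · simp [contains_append_tree, contains_cons_tree, hp, hp']
      · simp [contains_append_tree, contains_cons_tree, contains_of_contains_tree h.2,
          contains_of_contains_tree (q₁.2 h.2)]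
      · simp only [contains_append_two, contains_cons_tree, contains_cons_two, hp, hp', q₂,
          c₁, c₂, not_nil_contains_cons, and_true, and_false, or_false, true_and]
        simp only [or_comm, or_left_comm, or_assoc]
    · have hp : ¬ Contains L (cons p (tree q)) := fun H => h ⟨H.head, H.tail⟩
      have hq : ¬ Contains L (cons q (tree p)) := fun H => h ⟨H.tail, H.head⟩
      refine ⟨?_, ?_, ?_, ?_, ?_⟩
      · simp [s₂]; omega
      · simp [l₂]
      · simp only [contains_append_tree, contains_cons_tree, p₂, not_nil_contains_cons]
        rw [or_false, or_comm]
      · simp only [contains_append_tree, contains_cons_tree, q₂, not_nil_contains_cons]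
        rw [or_false, or_comm]
      · simp only [contains_append_two, contains_cons_tree, contains_cons_two, hp, hq, q₂,
          c₂, not_nil_contains_cons, false_or, or_false, and_false]
        rw [or_comm, and_comm]

theorem swapTwo_involutive : Function.Involutive (swapTwo p q) := by
  intro X
  induction X with
  | nil => simp [swapTwo]
  | cons L R ihL ihR =>
    rw [swapTwo, swapTwo_append, ihR]
    split_ifs with h
    · simp [swapTwo, (swapTwo_spec p q L).2.2.1, (swapTwo_spec p q L).2.2.2.1, h, ihL]
    · simp [swapTwo, h]

theorem equidistributed_swap : Equidistributed (cons p (tree q)) (cons q (tree p)) :=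
  ⟨(swapTwo_involutive p q).toPerm, fun X => ⟨(swapTwo_spec p q X).1,
    (swapTwo_spec p q X).2.1, (swapTwo_spec p q X).2.2.2.2⟩⟩

end swapTwo

end Forest

/-! ### Avoidance series -/

namespace Forest

theorem finite_size_le (n : ℕ) : {X : Forest | X.size ≤ n}.Finite := by
  induction n with
  | zero =>
    refine (Set.finite_singleton nil).subset fun X hX => ?_
    cases X with
    | nil => rfl
    | cons L R => simp at hX
  | succ n ih =>
    refine ((Set.finite_singleton nil).union (ih.image2 cons ih)).subset fun X hX => ?_
    cases X with
    | nil => exact .inl rfl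
    | cons L R =>
      simp only [Set.mem_ofPred_eq, size_cons] at hX
      exact .inr ⟨L, by simp only [Set.mem_ofPred_eq]; omega, R,
        by simp only [Set.mem_ofPred_eq]; omega, rfl⟩

/-- The forests with `n` vertices. -/
noncomputable def ofSize (n : ℕ) : Finset Forest :=
  ((finite_size_le n).subset fun (X : Forest) (h : X.size = n) => h.le).toFinset

@[simp] theorem mem_ofSize {n : ℕ} {X : Forest} : X ∈ ofSize n ↔ X.size = n := by
  exact Set.Finite.mem_toFinset _

theorem ofSize_zero : ofSize 0 = {nil} := by
  ext X
  cases X <;> simp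

theorem sum_ofSize_succ {M : Type*} [AddCommMonoid M] (n : ℕ) (f : Forest → M) :
    ∑ X ∈ ofSize (n + 1), f X = ∑ ij ∈ Finset.HasAntidiagonal.antidiagonal n,
      ∑ L ∈ ofSize ij.1, ∑ R ∈ ofSize ij.2, f (cons L R) := by
  simp_rw [← Finset.sum_product', Finset.sum_sigma']
  symm
  refine Finset.sum_bij (fun x _ => cons x.2.1 x.2.2) ?_ ?_ ?_ ?_
  · rintro ⟨⟨i, j⟩, L, R⟩ h
    simp only [Finset.mem_sigma, Finset.HasAntidiagonal.mem_antidiagonal, Finset.mem_product, mem_ofSize] at h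
    simp only [mem_ofSize, size_cons]
    omega
  · rintro ⟨⟨i, j⟩, L, R⟩ h ⟨⟨i', j'⟩, L', R'⟩ h' e
    simp only [Finset.mem_sigma, Finset.mem_product, mem_ofSize] at h h'
    obtain ⟨rfl, rfl⟩ := cons.inj e
    obtain ⟨-, rfl, rfl⟩ := h
    obtain ⟨-, rfl, rfl⟩ := h'
    rfl
  · intro X h
    cases X with
    | nil => simp at h
    | cons L R =>
      refine ⟨⟨(L.size, R.size), L, R⟩, ?_, rfl⟩
      simpa using h
  · intros
    rfl

open PowerSeries

open Classical in
/-- The generating function, by the number of vertices, of the forests with the property `p`. -/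
noncomputable def gf (p : Forest → Prop) : PowerSeries ℤ :=
  mk fun n => ∑ X ∈ ofSize n, if p X then 1 else 0

/-- Splitting off the first tree gives two products of classes; `hd` keeps them disjoint, so that
their series add up. -/
theorem gf_eq_of_forall_cons {p q₁ r₁ q₂ r₂ : Forest → Prop} (h₀ : p nil)
    (h : ∀ L R, p (cons L R) ↔ q₁ L ∧ r₁ R ∨ q₂ L ∧ r₂ R) (hd : ∀ L, q₁ L → ¬ q₂ L) :
    gf p = 1 + X * (gf q₁ * gf r₁ + gf q₂ * gf r₂) := by
  ext n
  cases n with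
  | zero => simp only [gf, coeff_mk, ofSize_zero, Finset.sum_singleton, if_pos h₀]; simp
  | succ n =>
    rw [map_add, coeff_succ_X_mul, map_add, coeff_mul, coeff_mul, ← Finset.sum_add_distrib]
    simp only [gf, coeff_mk, sum_ofSize_succ, coeff_one, Nat.add_eq_zero_iff, one_ne_zero,
      and_false, if_false, zero_add]
    refine Finset.sum_congr rfl fun ij _ => ?_
    simp_rw [Finset.sum_mul_sum, ← Finset.sum_add_distrib]
    refine Finset.sum_congr rfl fun L _ => Finset.sum_congr rfl fun R _ => ?_
    have := hd L
    by_cases a : q₁ L <;> by_cases b : q₂ L <;> by_cases c : r₁ R <;> by_cases d : r₂ R <;>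
      simp_all

theorem gf_eq_add (p q : Forest → Prop) :
    gf p = gf (fun X => p X ∧ q X) + gf (fun X => p X ∧ ¬ q X) := by
  ext n
  simp only [gf, coeff_mk, map_add, ← Finset.sum_add_distrib]
  refine Finset.sum_congr rfl fun X _ => ?_
  by_cases a : p X <;> by_cases b : q X <;> simp [a, b]

theorem gf_false : gf (fun _ => False) = 0 := by
  ext n
  simp [gf]

/-- The generating function of the forests that do not contain `P`. -/
noncomputable def avoidGF (P : Forest) : PowerSeries ℤ := gf fun X => ¬ Contains X P

theorem avoidGF_nil : avoidGF nil = 0 := by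
  simp [avoidGF, gf_false]

theorem avoidGF_tree (p : Forest) : avoidGF (tree p) * (1 - X * avoidGF p) = 1 := by
  -- One product is enough here; the second alternative is made empty.
  have h : avoidGF (tree p) = 1 + X * (avoidGF p * avoidGF (tree p) + _) :=
    gf_eq_of_forall_cons (q₂ := fun _ => False) (r₂ := fun _ => False) (by simp)
      (by simp [contains_cons_tree]) (fun _ _ => id)
  rw [gf_false] at h
  linear_combination h

/-- If the first subforest avoids `p`, the remaining trees must avoid the whole pattern. If it
contains `p` but not the pattern, they must avoid `tree q`. Avoiding `p` implies avoiding the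
pattern, so the subforests of the second kind are counted by a difference of series, and the
equation is linear in the unknown. -/
theorem avoidGF_two (p q : Forest) :
    avoidGF (cons p (tree q)) * ((1 - X * avoidGF p) * (1 - X * avoidGF q) - X) =
      1 - X * avoidGF p - X * avoidGF q := by
  have h : avoidGF (cons p (tree q)) = 1 + X * (avoidGF p * avoidGF (cons p (tree q)) +
      gf (fun X => ¬ Contains X (cons p (tree q)) ∧ Contains X p) * avoidGF (tree q)) := by
    refine gf_eq_of_forall_cons (by simp) (fun L R => ?_) fun L h h' => h h'.2
    rw [contains_cons_two]
    have h₁ : Contains L (cons p (tree q)) → Contains L p :=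
      fun h => contains_of_contains_tree h.head
    have h₂ : Contains R (cons p (tree q)) → Contains R (tree q) := .tail
    tauto
  have h' := gf_eq_add (fun X => ¬ Contains X (cons p (tree q))) (fun X => Contains X p)
  have e : (fun X => ¬ Contains X (cons p (tree q)) ∧ ¬ Contains X p) =
      fun X => ¬ Contains X p := by
    ext X
    exact and_iff_right_of_imp (mt fun h => contains_of_contains_tree h.head)
  rw [e] at h'
  change avoidGF (cons p (tree q)) = _ + avoidGF p at h'
  have hq := avoidGF_tree q
  set G := gf (fun X => ¬ Contains X (cons p (tree q)) ∧ Contains X p)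
  linear_combination (1 - X * avoidGF q) * h - X * h' + X * G * hq

/-! ### Fractions and rotation -/

/-- `D * avoidGF P = N`, with `D` a power series with constant coefficient `1`. -/
structure IsAvoidFraction (P : Forest) (N D : PowerSeries ℤ) : Prop where
  mul_eq : avoidGF P * D = N
  constantCoeff_eq : constantCoeff D = 1

namespace IsAvoidFraction

variable {P Q p : Forest} {N D N' D' n d : PowerSeries ℤ}

theorem avoidGF_eq (h : IsAvoidFraction P N D) (h' : IsAvoidFraction Q N' D') (hN : N = N')
    (hD : D = D') : avoidGF P = avoidGF Q := by
  subst hN hD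
  -- The constant coefficient `1` makes `D` nonzero, hence cancellable.
  refine mul_right_cancel₀ (b := D) ?_ (h.mul_eq.trans h'.mul_eq.symm)
  rintro rfl
  simpa using h.constantCoeff_eq

theorem nil : IsAvoidFraction nil 0 1 := ⟨by simp [avoidGF_nil], by simp⟩

theorem tree (h : IsAvoidFraction P N D) : IsAvoidFraction (tree P) D (D - X * N) :=
  ⟨by linear_combination avoidGF (Forest.tree P) * X * h.mul_eq + D * avoidGF_tree P,
    by simp [h.constantCoeff_eq]⟩

theorem two (h : IsAvoidFraction P N D) (h' : IsAvoidFraction Q N' D') :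
    IsAvoidFraction (cons P (Forest.tree Q)) (D * D' - X * N * D' - X * N' * D)
      ((D - X * N) * (D' - X * N') - X * (D * D')) := by
  refine ⟨?_, by simp [h.constantCoeff_eq, h'.constantCoeff_eq]⟩
  have e : avoidGF (cons P (Forest.tree Q)) * ((D - X * N) * (D' - X * N') - X * (D * D')) =
      D * D' * (avoidGF (cons P (Forest.tree Q)) *
        ((1 - X * avoidGF P) * (1 - X * avoidGF Q) - X)) := by
    rw [← h.mul_eq, ← h'.mul_eq]
    ring
  rw [e, avoidGF_two, ← h.mul_eq, ← h'.mul_eq]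
  ring

theorem self (P : Forest) : IsAvoidFraction P (avoidGF P) 1 := ⟨mul_one _, by simp⟩

end IsAvoidFraction

/-- The rule has no context, so equal series suffice. In each case the fractions of the two sides
have the same numerator and denominator as polynomials in X and the series of `p`, `q`, `r`. -/
theorem avoidGF_rotate {a b c : Forest} (ha : a = nil ∨ ∃ p, a = tree p)
    (hb : b = nil ∨ ∃ q, b = tree q) (hc : c = nil ∨ ∃ r, c = tree r) :
    avoidGF (a ++ tree (b ++ c)) = avoidGF (tree (a ++ b) ++ c) := by
  have s := IsAvoidFraction.self
  rcases ha with rfl | ⟨p, rfl⟩ <;> rcases hb with rfl | ⟨q, rfl⟩ <;>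
    rcases hc with rfl | ⟨r, rfl⟩ <;>
    simp only [nil_append, append_nil, cons_append]
  · exact (s r).tree.tree.avoidGF_eq (IsAvoidFraction.nil.two (s r)) (by ring) (by ring)
  · exact ((s q).two (s r)).tree.avoidGF_eq ((s q).tree.two (s r)) (by ring) (by ring)
  · exact ((s p).two .nil).avoidGF_eq (s p).tree.tree (by ring) (by ring)
  · exact ((s p).two (s r).tree).avoidGF_eq ((s p).tree.two (s r)) (by ring) (by ring)
  · exact ((s p).two (s q).tree).avoidGF_eq ((s p).two (s q)).tree (by ring) (by ring)
  · exact ((s p).two ((s q).two (s r))).avoidGF_eq (((s p).two (s q)).two (s r))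
      (by ring) (by ring)

theorem avoidGF_tree_congr {p q : Forest} (h : avoidGF p = avoidGF q) :
    avoidGF (tree p) = avoidGF (tree q) :=
  (IsAvoidFraction.self p).tree.avoidGF_eq (IsAvoidFraction.self q).tree rfl (by rw [h])

theorem avoidGF_tree_injective {p q : Forest} (h : avoidGF (tree p) = avoidGF (tree q)) :
    avoidGF p = avoidGF q := by
  have hp := avoidGF_tree p
  have hq := avoidGF_tree q
  rw [← h] at hq
  refine mul_left_cancel₀ (a := avoidGF (tree p) * X) (mul_ne_zero ?_ X_ne_zero) ?_
  · intro h0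
    simp [h0] at hp
  · linear_combination hq - hp

/-- The empty forest avoids every non-empty pattern, so the constant coefficient is then nonzero. -/
theorem eq_nil_of_avoidGF_eq_zero {P : Forest} (h : avoidGF P = 0) : P = nil := by
  cases P with
  | nil => rfl
  | cons p q =>
    have := congrArg (coeff 0) h
    simp [avoidGF, gf, ofSize_zero, -coeff_zero_eq_constantCoeff] at this

/-! ### Bijections from equal series, and the rules with a context -/

open Classical in
theorem card_filter_not_contains (P : Forest) (n : ℕ) :
    ((((ofSize n).filter fun X => ¬ Contains X P).card : ℕ) : ℤ) = coeff n (avoidGF P) := by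
  rw [avoidGF, gf, coeff_mk, Finset.card_filter, Nat.cast_sum]
  refine Finset.sum_congr rfl fun X _ => ?_
  by_cases h : Contains X P <;> simp [h]

/-- There are finitely many forests of each size, so equal numbers of avoiders force equal numbers
of containers. Bijections between these fibres are glued together. -/
theorem exists_equiv_of_avoidGF_eq {P Q : Forest} (h : avoidGF P = avoidGF Q) :
    ∃ e : Forest ≃ Forest, ∀ X, (e X).size = X.size ∧ (Contains (e X) Q ↔ Contains X P) := by
  classical
  have hn (n : ℕ) : ((ofSize n).filter fun X => ¬ Contains X P).card =
      ((ofSize n).filter fun X => ¬ Contains X Q).card := by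
    have := card_filter_not_contains P n
    rw [h, ← card_filter_not_contains Q n] at this
    exact_mod_cast this
  have hc (n : ℕ) : ((ofSize n).filter fun X => Contains X P).card =
      ((ofSize n).filter fun X => Contains X Q).card := by
    have h₁ := Finset.card_filter_add_card_filter_not (s := ofSize n) (fun X => Contains X P)
    have h₂ := Finset.card_filter_add_card_filter_not (s := ofSize n) (fun X => Contains X Q)
    have := hn n
    omega
  have key (c : ℕ × Prop) : Nonempty ({X : Forest // (X.size, Contains X P) = c} ≃
      {X : Forest // (X.size, Contains X Q) = c}) := by
    obtain ⟨n, c⟩ := c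
    by_cases hP : c
    · refine ⟨((Equiv.subtypeEquivRight fun X => ?_).trans (Finset.equivOfCardEq (hc n))).trans
        (Equiv.subtypeEquivRight fun X => ?_)⟩ <;> simp [hP]
    · refine ⟨((Equiv.subtypeEquivRight fun X => ?_).trans (Finset.equivOfCardEq (hn n))).trans
        (Equiv.subtypeEquivRight fun X => ?_)⟩ <;> simp [hP]
  let e : Forest ≃ Forest := Equiv.ofFiberEquiv (f := fun X : Forest => (X.size, Contains X P))
    (g := fun X : Forest => (X.size, Contains X Q)) fun c => (key c).some
  refine ⟨e, fun X => ?_⟩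
  have := Equiv.ofFiberEquiv_map (f := fun X : Forest => (X.size, Contains X P))
    (g := fun X : Forest => (X.size, Contains X Q)) (fun c => (key c).some) X
  exact ⟨congrArg Prod.fst this, iff_of_eq (congrArg Prod.snd this)⟩

theorem Equidistributed.avoidGF_eq {P Q : Forest} : Equidistributed P Q →
    avoidGF P = avoidGF Q := by
  classical
  rintro ⟨e, he⟩
  ext n
  simp only [avoidGF, gf, coeff_mk]
  exact Finset.sum_equiv e (by simp [he]) (by simp [he])

/-- The map that applies `f` to the forest of subtrees of each root. -/
def mapSubtrees (f : Forest → Forest) : Forest → Forest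
  | nil => nil
  | cons L R => cons (f L) (mapSubtrees f R)

theorem mapSubtrees_leftInverse {f g : Forest → Forest} (h : Function.LeftInverse g f) :
    Function.LeftInverse (mapSubtrees g) (mapSubtrees f) := by
  intro X
  induction X with
  | nil => rfl
  | cons L R _ ih => simp [mapSubtrees, h L, ih]

/-- A bijection obtained from equal series need not preserve the number of trees, but applying it
below each root does. -/
theorem equidistributed_tree {p q : Forest} (h : avoidGF (tree p) = avoidGF (tree q)) :
    Equidistributed (tree p) (tree q) := by
  obtain ⟨e, he⟩ := exists_equiv_of_avoidGF_eq (avoidGF_tree_injective h)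
  refine ⟨⟨mapSubtrees e, mapSubtrees e.symm, mapSubtrees_leftInverse e.symm_apply_apply,
    mapSubtrees_leftInverse e.apply_symm_apply⟩, fun X => ?_⟩
  induction X with
  | nil => simp [mapSubtrees]
  | cons L R _ ih =>
    simp only [Equiv.coe_fn_mk] at ih
    simp [mapSubtrees, contains_cons_tree, he, ih]

theorem avoidGF_append_congr {a b : Forest} (P Q : Forest) (ha : a = nil ∨ ∃ p, a = tree p)
    (hb : b = nil ∨ ∃ q, b = tree q) (h : avoidGF a = avoidGF b) :
    avoidGF (P ++ a ++ Q) = avoidGF (P ++ b ++ Q) := by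
  rcases ha with rfl | ⟨p, rfl⟩
  · rw [eq_nil_of_avoidGF_eq_zero (h.symm.trans avoidGF_nil)]
  rcases hb with rfl | ⟨q, rfl⟩
  · rw [eq_nil_of_avoidGF_eq_zero (h.trans avoidGF_nil)]
  exact (((equidistributed_tree h).append_left P).append_right Q).avoidGF_eq

theorem avoidGF_append_comm {a b : Forest} (P Q : Forest) (ha : a = nil ∨ ∃ p, a = tree p)
    (hb : b = nil ∨ ∃ q, b = tree q) :
    avoidGF (P ++ a ++ b ++ Q) = avoidGF (P ++ b ++ a ++ Q) := by
  rcases ha with rfl | ⟨p, rfl⟩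
  · simp
  rcases hb with rfl | ⟨q, rfl⟩
  · simp
  rw [append_assoc P (tree p), append_assoc P (tree q)]
  exact (((equidistributed_swap p q).append_left P).append_right Q).avoidGF_eq

end Forest

/-! ### Decomposition of arch systems at the first arch -/

namespace ArchSystem

theorem lt_and_lt {X : ArchSystem} {a : ℕ × ℕ} (h : a ∈ X.arches) :
    a.1 < a.2 ∧ a.2 < 2 * X.size :=
  ⟨X.left_lt_right a h, X.right_lt a h⟩

theorem eq_of_mem {X : ArchSystem} {a b : ℕ × ℕ} (ha : a ∈ X.arches) (hb : b ∈ X.arches)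
    (h : a.1 = b.1 ∨ a.1 = b.2 ∨ a.2 = b.1 ∨ a.2 = b.2) : a = b := by
  have ha' := lt_and_lt ha
  have key (p : ℕ) (hp : p < 2 * X.size) (h₁ : p = a.1 ∨ p = a.2) (h₂ : p = b.1 ∨ p = b.2) :
      a = b := (X.existsUnique_arch p hp).unique ⟨ha, h₁⟩ ⟨hb, h₂⟩
  rcases h with h | h | h | h
  · exact key a.1 (by omega) (.inl rfl) (.inl h)
  · exact key a.1 (by omega) (.inl rfl) (.inr h)
  · exact key a.2 (by omega) (.inr rfl) (.inl h)
  · exact key a.2 (by omega) (.inr rfl) (.inr h)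

theorem arches_append (A B : ArchSystem) :
    (A ++ B).arches = A.arches ∪ B.shifted (2 * A.size) := rfl

theorem mem_append {A B : ArchSystem} {a : ℕ × ℕ} : a ∈ (A ++ B).arches ↔
    a ∈ A.arches ∨ ∃ b ∈ B.arches, a = (b.1 + 2 * A.size, b.2 + 2 * A.size) := by
  rw [arches_append, Finset.mem_union, mem_shifted]

theorem mem_archOver {A : ArchSystem} {a : ℕ × ℕ} : a ∈ A.archOver.arches ↔
    a = (0, 2 * A.size + 1) ∨ ∃ b ∈ A.arches, a = (b.1 + 1, b.2 + 1) := by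
  rw [archOver, Finset.mem_insert, mem_shifted]

@[simp] theorem size_empty : empty.size = 0 := rfl

@[simp] theorem size_append (A B : ArchSystem) : (A ++ B).size = A.size + B.size :=
  card_concat A B

@[simp] theorem size_archOver (A : ArchSystem) : A.archOver.size = A.size + 1 :=
  card_archOver A

theorem notMem_empty (a : ℕ × ℕ) : a ∉ empty.arches := Finset.notMem_empty a

@[simp] theorem empty_append (A : ArchSystem) : empty ++ A = A := by
  ext a
  simp [mem_append, notMem_empty]

@[simp] theorem append_empty (A : ArchSystem) : A ++ empty = A := by
  ext a
  simp [mem_append, notMem_empty]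

theorem append_assoc (A B C : ArchSystem) : A ++ B ++ C = A ++ (B ++ C) := by
  ext a
  simp only [mem_append, size_append, or_assoc]
  refine or_congr_right ⟨?_, ?_⟩
  · rintro (⟨b, hb, rfl⟩ | ⟨b, hb, rfl⟩)
    · exact ⟨b, .inl hb, rfl⟩
    · exact ⟨_, .inr ⟨b, hb, rfl⟩, by ext <;> simp <;> omega⟩
  · rintro ⟨_, hb | ⟨b, hb, rfl⟩, rfl⟩
    · exact .inl ⟨_, hb, rfl⟩
    · exact .inr ⟨b, hb, by ext <;> simp <;> omega⟩

theorem mem_archOver_append {L R : ArchSystem} {a : ℕ × ℕ} :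
    a ∈ (L.archOver ++ R).arches ↔ a = (0, 2 * L.size + 1) ∨
      (∃ b ∈ L.arches, a = (b.1 + 1, b.2 + 1)) ∨
      ∃ b ∈ R.arches, a = (b.1 + (2 * L.size + 2), b.2 + (2 * L.size + 2)) := by
  rw [mem_append, mem_archOver, or_assoc, size_archOver, mul_add_one]

theorem mem_iff_of_inside {L : ArchSystem} (R : ArchSystem) {a : ℕ × ℕ} :
    a ∈ L.arches ↔ (a.1 + 1, a.2 + 1) ∈ (L.archOver ++ R).arches ∧ a.2 < 2 * L.size := by
  refine ⟨fun h => ⟨mem_archOver_append.2 (.inr (.inl ⟨a, h, rfl⟩)), (lt_and_lt h).2⟩, ?_⟩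
  rintro ⟨h, h'⟩
  rcases mem_archOver_append.1 h with h | ⟨b, hb, h⟩ | ⟨b, hb, h⟩ <;>
    simp only [Prod.mk.injEq] at h
  · omega
  · rwa [show a = b by ext <;> omega]
  · omega

theorem mem_iff_of_right {R : ArchSystem} (L : ArchSystem) {a : ℕ × ℕ} :
    a ∈ R.arches ↔ (a.1 + (2 * L.size + 2), a.2 + (2 * L.size + 2)) ∈
      (L.archOver ++ R).arches := by
  refine ⟨fun h => mem_archOver_append.2 (.inr (.inr ⟨a, h, rfl⟩)), fun h => ?_⟩
  rcases mem_archOver_append.1 h with h | ⟨b, hb, h⟩ | ⟨b, hb, h⟩ <;>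
    simp only [Prod.mk.injEq] at h
  · omega
  · have := lt_and_lt hb
    omega
  · rwa [show a = b by ext <;> omega]

/-- The arch at the point `0` is unique, and its right end determines where to cut. -/
theorem eq_of_archOver_append_eq {L R L' R' : ArchSystem}
    (h : L.archOver ++ R = L'.archOver ++ R') : L = L' ∧ R = R' := by
  have h₁ : (0, 2 * L.size + 1) ∈ (L.archOver ++ R).arches := mem_archOver_append.2 (.inl rfl)
  have h₂ : (0, 2 * L'.size + 1) ∈ (L.archOver ++ R).arches :=
    h ▸ mem_archOver_append.2 (.inl rfl)
  have e := eq_of_mem h₁ h₂ (.inl rfl)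
  have e : L.size = L'.size := by
    simp only [Prod.mk.injEq] at e
    omega
  constructor
  · ext a
    rw [mem_iff_of_inside (L := L) R, mem_iff_of_inside (L := L') R', h, e]
  · ext a
    rw [mem_iff_of_right (R := R) L, mem_iff_of_right (R := R') L', h, e]

/-- Incidences of points and arches are counted twice: one per point, two per arch. -/
theorem two_mul_card_of_existsUnique {S : Finset (ℕ × ℕ)} {m : ℕ} (h₁ : ∀ a ∈ S, a.1 < a.2)
    (h₂ : ∀ a ∈ S, a.2 < m) (h₃ : ∀ p < m, ∃! a, a ∈ S ∧ (p = a.1 ∨ p = a.2)) :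
    2 * S.card = m := by
  have h := Finset.sum_card_bipartiteAbove_eq_sum_card_bipartiteBelow
    (fun p (a : ℕ × ℕ) => p = a.1 ∨ p = a.2) (s := Finset.range m) (t := S)
  rw [Finset.sum_congr rfl (g := fun _ => 1), Finset.sum_congr rfl (s₁ := S) (g := fun _ => 2)] at h
  · simp at h
    omega
  · intro a ha
    have := h₁ a ha
    have := h₂ a ha
    rw [← Finset.card_pair (h₁ a ha).ne]
    congr 1
    ext p
    simp only [Finset.mem_bipartiteBelow, Finset.mem_range, Finset.mem_insert,
      Finset.mem_singleton]
    omega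
  · intro p hp
    rw [Finset.card_eq_one]
    obtain ⟨a, ha, hu⟩ := h₃ p (Finset.mem_range.1 hp)
    refine ⟨a, ?_⟩
    ext b
    simp only [Finset.mem_bipartiteAbove, Finset.mem_singleton]
    exact ⟨hu b, fun h => h ▸ ha⟩

/-- The arches of `X` on an interval of points that no arch leaves form an arch system. -/
theorem exists_restrict (X : ArchSystem) (k m : ℕ) (hm : k + m ≤ 2 * X.size)
    (hX : ∀ a ∈ X.arches, k ≤ a.1 ∧ a.1 < k + m ∨ k ≤ a.2 ∧ a.2 < k + m →
      k ≤ a.1 ∧ a.2 < k + m) :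
    ∃ Y : ArchSystem, 2 * Y.size = m ∧
      ∀ a, a ∈ Y.arches ↔ (a.1 + k, a.2 + k) ∈ X.arches ∧ a.2 < m := by
  let S : Finset (ℕ × ℕ) := (X.arches.preimage _ (shiftArch k).injective.injOn).filter (·.2 < m)
  have hS (a : ℕ × ℕ) : a ∈ S ↔ (a.1 + k, a.2 + k) ∈ X.arches ∧ a.2 < m := by
    simp only [S, Finset.mem_filter, Finset.mem_preimage]
    rfl
  have h₁ : ∀ a ∈ S, a.1 < a.2 := fun a ha => by
    have := lt_and_lt ((hS a).1 ha).1
    simp only at this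
    omega
  have h₂ : ∀ a ∈ S, a.2 < m := fun a ha => ((hS a).1 ha).2
  have h₃ : ∀ p < m, ∃! a, a ∈ S ∧ (p = a.1 ∨ p = a.2) := by
    intro p hp
    obtain ⟨a, ⟨ha, hpa⟩, hu⟩ := X.existsUnique_arch (p + k) (by simp only [size] at hm; omega)
    have h := hX a ha (by omega)
    have h' := lt_and_lt ha
    refine ⟨(a.1 - k, a.2 - k), ⟨(hS _).2 ⟨?_, ?_⟩, ?_⟩, ?_⟩
    · simp only
      rwa [Nat.sub_add_cancel h.1, Nat.sub_add_cancel (by omega)]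
    · simp only
      omega
    · simp only
      omega
    · rintro b ⟨hb, hpb⟩
      rw [← hu _ ⟨((hS b).1 hb).1, by simp only; omega⟩]
      simp
  have hc := two_mul_card_of_existsUnique h₁ h₂ h₃
  refine ⟨⟨S, h₁, fun a ha => hc ▸ h₂ a ha, fun p hp => h₃ p (hc ▸ hp), fun a ha b hb => ?_⟩,
    hc, hS⟩
  have := X.noncrossing _ ((hS a).1 ha).1 _ ((hS b).1 hb).1
  simp only at this
  omega

theorem eq_empty_of_size_eq_zero {X : ArchSystem} (h : X.size = 0) : X = empty :=
  ArchSystem.ext (Finset.card_eq_zero.1 h)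

/-- Let `r` be the partner of the point `0`. By non-crossing, every other arch lies entirely before
or entirely after `r`. -/
theorem exists_eq_archOver_append {X : ArchSystem} (hX : X ≠ empty) :
    ∃ L R : ArchSystem, X = L.archOver ++ R := by
  have h0 : 0 < X.size := Nat.pos_of_ne_zero (mt eq_empty_of_size_eq_zero hX)
  obtain ⟨⟨i, r⟩, ⟨he, hi⟩, -⟩ := X.existsUnique_arch 0 (by simp only [size] at h0; omega)
  have her := lt_and_lt he
  simp only at hi her
  obtain rfl : i = 0 := by omega
  have hne (a : ℕ × ℕ) (ha : a ∈ X.arches) : a = (0, r) ∨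
      0 < a.1 ∧ a.1 ≠ r ∧ a.2 ≠ r ∧ ¬ (a.1 < r ∧ r < a.2) := by
    by_cases h : a = (0, r)
    · exact .inl h
    · have h₁ := mt (eq_of_mem ha he) h
      have h₂ := X.noncrossing _ he a ha
      simp only at h₁ h₂
      exact .inr (by omega)
  obtain ⟨L, hL, hL'⟩ := X.exists_restrict 1 (r - 1) (by omega) fun a ha h => by
    have := lt_and_lt ha
    rcases hne a ha with rfl | h'
    · simp only at h
      omega
    · omega
  obtain ⟨R, hR, hR'⟩ := X.exists_restrict (r + 1) (2 * X.size - (r + 1)) (by omega)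
    fun a ha h => by
      have := lt_and_lt ha
      rcases hne a ha with rfl | h'
      · simp only at h
        omega
      · omega
  refine ⟨L, R, ?_⟩
  have hr : 2 * L.size + 1 = r := by omega
  ext a
  rw [mem_archOver_append, hr, show 2 * L.size + 2 = r + 1 by omega]
  constructor
  · intro ha
    have h := lt_and_lt ha
    rcases hne a ha with h' | h'
    · exact .inl h'
    · by_cases har : a.1 < r
      · refine .inr (.inl ⟨(a.1 - 1, a.2 - 1), (hL' _).2 ⟨?_, by simp only; omega⟩, ?_⟩)
        · simp only
          rwa [Nat.sub_add_cancel (by omega), Nat.sub_add_cancel (by omega)]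
        · ext <;> simp only <;> omega
      · refine .inr (.inr ⟨(a.1 - (r + 1), a.2 - (r + 1)),
          (hR' _).2 ⟨?_, by simp only; omega⟩, ?_⟩)
        · simp only
          rwa [Nat.sub_add_cancel (by omega), Nat.sub_add_cancel (by omega)]
        · ext <;> simp only <;> omega
  · rintro (rfl | ⟨b, hb, rfl⟩ | ⟨b, hb, rfl⟩)
    · exact he
    · exact ((hL' b).1 hb).1
    · exact ((hR' b).1 hb).1

/-! ### Subsystems of arch systems -/

theorem isSubsystem_of_lt {P X : ArchSystem} (f : ℕ → ℕ)
    (hf : ∀ p q, p < q → q < 2 * P.size → f p < f q)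
    (h : ∀ a ∈ P.arches, (f a.1, f a.2) ∈ X.arches) : IsSubsystem P X := by
  -- Beyond the points of `P` the values are irrelevant; they only have to increase and exceed the
  -- image of the last point.
  refine ⟨fun p => if p < 2 * P.size then f p else f (2 * P.size - 1) + 1 + p, ?_, ?_⟩
  · refine strictMono_nat_of_lt_succ fun p => ?_
    split_ifs with h₁ h₂
    · exact hf _ _ p.lt_succ_self h₂
    · rw [show 2 * P.size - 1 = p by omega]
      omega
    · omega
    · omega
  · intro a ha
    have := lt_and_lt ha
    dsimp only
    rw [if_pos (by omega), if_pos this.2]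
    exact h a ha

theorem empty_isSubsystem (X : ArchSystem) : IsSubsystem empty X :=
  ⟨id, strictMono_id, fun _ h => absurd h (notMem_empty _)⟩

theorem not_isSubsystem_empty {P : ArchSystem} (hP : P ≠ empty) : ¬ IsSubsystem P empty := by
  rintro ⟨f, -, h⟩
  refine hP (ArchSystem.ext (Finset.eq_empty_of_forall_notMem fun a ha => ?_))
  exact notMem_empty _ (h a ha)

theorem apply_lt_of_forall_mem {P X : ArchSystem} {f : ℕ → ℕ}
    (h : ∀ a ∈ P.arches, (f a.1, f a.2) ∈ X.arches) {p : ℕ} (hp : p < 2 * P.size) :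
    f p < 2 * X.size := by
  obtain ⟨a, ⟨ha, hpa⟩, -⟩ := P.existsUnique_arch p hp
  have := lt_and_lt (h a ha)
  simp only at this
  rcases hpa with rfl | rfl <;> omega

theorem IsSubsystem.trans {P Q X : ArchSystem} :
    IsSubsystem P Q → IsSubsystem Q X → IsSubsystem P X := by
  rintro ⟨f, hf, h⟩ ⟨g, hg, h'⟩
  exact ⟨g ∘ f, hg.comp hf, fun a ha => h' _ (h a ha)⟩

theorem append_isSubsystem_archOver_append (L R : ArchSystem) :
    IsSubsystem (L ++ R) (L.archOver ++ R) := by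
  refine isSubsystem_of_lt (fun p => if p < 2 * L.size then p + 1 else p + 2)
    (fun p q hpq _ => by split_ifs <;> omega) fun a ha => ?_
  rcases mem_append.1 ha with ha | ⟨b, hb, rfl⟩
  · have := lt_and_lt ha
    rw [if_pos (by omega), if_pos this.2]
    exact mem_archOver_append.2 (.inr (.inl ⟨a, ha, rfl⟩))
  · rw [if_neg (by simp), if_neg (by simp)]
    exact mem_archOver_append.2 (.inr (.inr ⟨b, hb, rfl⟩))

theorem IsSubsystem.archOver_append {p q L R : ArchSystem} :
    IsSubsystem p L → IsSubsystem q R → IsSubsystem (p.archOver ++ q) (L.archOver ++ R) := by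
  rintro ⟨f, hf, h⟩ ⟨g, hg, h'⟩
  have hfL (i : ℕ) (hi : i < 2 * p.size) := apply_lt_of_forall_mem h hi
  -- The four cases are the left end of the outer arch, the points under it, its right end and the
  -- points to its right.
  refine isSubsystem_of_lt (fun i => if i = 0 then 0 else if i < 2 * p.size + 1 then f (i - 1) + 1
    else if i = 2 * p.size + 1 then 2 * L.size + 1
    else g (i - (2 * p.size + 2)) + (2 * L.size + 2)) (fun i j hij _ => ?_) fun a ha => ?_
  · have h₁ := hfL (i - 1)
    have h₂ : i ≠ 0 → f (i - 1) < f (j - 1) := fun _ => hf (by omega)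
    have h₃ : 2 * p.size + 2 ≤ i → g (i - (2 * p.size + 2)) < g (j - (2 * p.size + 2)) :=
      fun _ => hg (by omega)
    split_ifs <;> omega
  · rcases mem_archOver_append.1 ha with rfl | ⟨b, hb, rfl⟩ | ⟨b, hb, rfl⟩
    · exact mem_archOver_append.2 (.inl (by simp))
    · have := lt_and_lt hb
      rw [if_neg (by simp), if_pos (by simp only; omega), if_neg (by simp),
        if_pos (by simp only; omega)]
      exact mem_archOver_append.2 (.inr (.inl ⟨_, h b hb, rfl⟩))
    · rw [if_neg (by simp), if_neg (by simp only; omega), if_neg (by simp only; omega),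
        if_neg (by simp), if_neg (by simp only; omega), if_neg (by simp only; omega)]
      exact mem_archOver_append.2 (.inr (.inr ⟨_, h' b hb, by simp⟩))

/-- If the point `0` is sent to `0`, then the outer arch goes to the outer arch, and the points
inside and to the right go to the corresponding parts. Otherwise no arch of the pattern uses the
outer arch of the target, which can be deleted. -/
theorem isSubsystem_archOver_append {p q L R : ArchSystem} :
    IsSubsystem (p.archOver ++ q) (L.archOver ++ R) ↔
      IsSubsystem p L ∧ IsSubsystem q R ∨ IsSubsystem (p.archOver ++ q) (L ++ R) := by
  refine ⟨?_, fun h => h.elim (fun h => h.1.archOver_append h.2)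
    fun h => h.trans (append_isSubsystem_archOver_append L R)⟩
  rintro ⟨f, hf, h⟩
  have hout : (0, 2 * L.size + 1) ∈ (L.archOver ++ R).arches := mem_archOver_append.2 (.inl rfl)
  by_cases h0 : f 0 = 0
  · have h₁ := h _ (mem_archOver_append.2 (.inl rfl))
    have e := eq_of_mem h₁ hout (.inl h0)
    simp only [Prod.mk.injEq] at e
    left
    constructor
    · refine ⟨fun i => f (i + 1) - 1, fun i j hij => ?_, fun a ha => ?_⟩
      · have h₂ := hf (show 0 < i + 1 by omega)
        have h₃ := hf (show i + 1 < j + 1 by omega)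
        dsimp only
        omega
      · have := lt_and_lt ha
        have h₂ := hf (show 0 < a.1 + 1 by omega)
        have h₃ := hf (show 0 < a.2 + 1 by omega)
        have h₄ := hf (show a.2 + 1 < 2 * p.size + 1 by omega)
        rw [mem_iff_of_inside R]
        refine ⟨?_, by dsimp only; omega⟩
        dsimp only
        rw [Nat.sub_add_cancel (by omega), Nat.sub_add_cancel (by omega)]
        exact h _ (mem_archOver_append.2 (.inr (.inl ⟨a, ha, rfl⟩)))
    · have hbig (i : ℕ) : 2 * L.size + 1 < f (i + (2 * p.size + 2)) :=
        e.2 ▸ hf (show 2 * p.size + 1 < _ by omega)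
      refine ⟨fun i => f (i + (2 * p.size + 2)) - (2 * L.size + 2), fun i j hij => ?_,
        fun a ha => ?_⟩
      · have h₂ := hbig i
        have h₃ := hf (show i + (2 * p.size + 2) < j + (2 * p.size + 2) by omega)
        dsimp only
        omega
      · rw [mem_iff_of_right L]
        have h₂ := hbig a.1
        have h₃ := hbig a.2
        dsimp only
        rw [Nat.sub_add_cancel (by omega), Nat.sub_add_cancel (by omega)]
        exact h _ (mem_archOver_append.2 (.inr (.inr ⟨a, ha, rfl⟩)))
  · right
    have hpos (i : ℕ) : f i ≠ 0 := by
      have := hf.monotone i.zero_le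
      omega
    have hne (i : ℕ) (hi : i < 2 * (p.archOver ++ q).size) : f i ≠ 2 * L.size + 1 := by
      obtain ⟨a, ⟨ha, hia⟩, -⟩ := (p.archOver ++ q).existsUnique_arch i hi
      intro hfi
      have e := eq_of_mem (h a ha) hout (by rcases hia with rfl | rfl <;> simp [hfi])
      exact hpos _ (congrArg Prod.fst e)
    -- Deleting the outer arch moves the points under it by one and those to its right by two.
    refine isSubsystem_of_lt (fun i => if f i < 2 * L.size + 1 then f i - 1 else f i - 2)
      (fun i j hij hj => ?_) fun a ha => ?_
    · have := hf hij
      have := hpos i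
      have := hne j hj
      have := hne i (hij.trans hj)
      split_ifs <;> omega
    · rw [mem_append]
      rcases mem_archOver_append.1 (h a ha) with e | ⟨b, hb, e⟩ | ⟨b, hb, e⟩ <;>
        simp only [Prod.mk.injEq] at e
      · exact absurd e.1 (hpos _)
      · have := lt_and_lt hb
        rw [if_pos (by omega), if_pos (by omega), e.1, e.2]
        exact .inl hb
      · rw [if_neg (by omega), if_neg (by omega), e.1, e.2]
        exact .inr ⟨b, hb, by ext <;> simp only <;> omega⟩

/-! ### Arch systems as forests -/

/-- The arch system whose arches are nested as the vertices of a forest are. -/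
def ofForest : Forest → ArchSystem
  | .nil => empty
  | .cons L R => (ofForest L).archOver ++ ofForest R

theorem archOver_append_ne_empty (L R : ArchSystem) : L.archOver ++ R ≠ empty := fun h => by
  have := congrArg size h
  simp at this

theorem size_ofForest (X : Forest) : (ofForest X).size = X.size := by
  induction X with
  | nil => rfl
  | cons L R ihL ihR =>
    simp only [ofForest, size_append, size_archOver, ihL, ihR, Forest.size_cons]
    omega

theorem ofForest_append (X Y : Forest) : ofForest (X ++ Y) = ofForest X ++ ofForest Y := by
  induction X with
  | nil => simp [ofForest]
  | cons L R _ ih => simp [ofForest, ih, append_assoc]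

theorem ofForest_tree (X : Forest) : ofForest (Forest.tree X) = (ofForest X).archOver := by
  simp [ofForest]

theorem ofForest_injective : Function.Injective ofForest := by
  intro X
  induction X with
  | nil =>
    rintro (_ | ⟨L, R⟩) h
    exacts [rfl, absurd h.symm (archOver_append_ne_empty _ _)]
  | cons L R ihL ihR =>
    rintro (_ | ⟨L', R'⟩) h
    · exact absurd h (archOver_append_ne_empty _ _)
    · obtain ⟨h₁, h₂⟩ := eq_of_archOver_append_eq h
      rw [ihL h₁, ihR h₂]

theorem ofForest_surjective : Function.Surjective ofForest := by
  intro A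
  induction hn : A.size using Nat.strong_induction_on generalizing A with
  | _ n ih =>
    by_cases hA : A = empty
    · exact ⟨.nil, hA.symm⟩
    · obtain ⟨L, R, rfl⟩ := exists_eq_archOver_append hA
      simp only [size_append, size_archOver] at hn
      obtain ⟨X, rfl⟩ := ih _ (by omega) L rfl
      obtain ⟨Y, rfl⟩ := ih _ (by omega) R rfl
      exact ⟨.cons X Y, rfl⟩

/-- Both relations satisfy the same recursion, `isSubsystem_archOver_append` and
`contains_cons_cons`. -/
theorem isSubsystem_ofForest {P X : Forest} :
    IsSubsystem (ofForest P) (ofForest X) ↔ X.Contains P := by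
  induction hn : X.size using Nat.strong_induction_on generalizing X P with
  | _ n ih =>
    subst hn
    cases P with
    | nil => exact iff_of_true (empty_isSubsystem _) (.base _)
    | cons p q =>
      cases X with
      | nil =>
        exact iff_of_false (not_isSubsystem_empty (archOver_append_ne_empty _ _))
          (Forest.not_nil_contains_cons p q)
      | cons L R =>
        rw [Forest.contains_cons_cons, ← ih L.size (by simp) rfl,
          ← ih R.size (by simp) rfl,
          ← ih _ (by simp) rfl, ofForest_append]
        exact isSubsystem_archOver_append

theorem genFun_Av_ofForest (P : Forest) : genFun (Av (ofForest P)) = Forest.avoidGF P := by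
  classical
  ext n
  rw [← Forest.card_filter_not_contains, genFun, PowerSeries.coeff_mk, ← Set.ncard_coe_finset,
    ← Set.ncard_image_of_injective _ ofForest_injective]
  congr 2
  ext A
  obtain ⟨X, rfl⟩ := ofForest_surjective A
  simp [Av, ofForest_injective.mem_set_image, isSubsystem_ofForest, size_ofForest, and_comm]

theorem IsAtomicOrEmpty.exists_forest {a : ArchSystem} (h : a.IsAtomicOrEmpty) :
    ∃ X : Forest, ofForest X = a ∧ (X = .nil ∨ ∃ p, X = Forest.tree p) := by
  rcases h with ⟨h, h'⟩ | rfl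
  · obtain ⟨L, R, rfl⟩ := exists_eq_archOver_append h
    obtain ⟨p, rfl⟩ := ofForest_surjective L
    rcases h' _ _ rfl with e | rfl
    · simpa using congrArg size e
    · exact ⟨Forest.tree p, rfl, .inr ⟨p, rfl⟩⟩
  · exact ⟨.nil, rfl, .inl rfl⟩

/-! ### Wilf-equivalence -/

theorem Sim.genFun_eq {A B : ArchSystem} (h : Sim A B) : genFun (Av A) = genFun (Av B) := by
  induction h with
  | refl => rfl
  | symm _ ih => exact ih.symm
  | trans _ _ ih ih' => exact ih.trans ih'
  | @archOver A B _ ih =>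
    obtain ⟨X, rfl⟩ := ofForest_surjective A
    obtain ⟨Y, rfl⟩ := ofForest_surjective B
    simp only [← ofForest_tree, genFun_Av_ofForest] at ih ⊢
    exact Forest.avoidGF_tree_congr ih
  | substitute P Q ha hb _ ih =>
    obtain ⟨X, rfl⟩ := ofForest_surjective P
    obtain ⟨Y, rfl⟩ := ofForest_surjective Q
    obtain ⟨a, rfl, ha'⟩ := ha.exists_forest
    obtain ⟨b, rfl, hb'⟩ := hb.exists_forest
    simp only [← ofForest_append, genFun_Av_ofForest] at ih ⊢
    exact Forest.avoidGF_append_congr X Y ha' hb' ih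
  | commute P Q ha hb =>
    obtain ⟨X, rfl⟩ := ofForest_surjective P
    obtain ⟨Y, rfl⟩ := ofForest_surjective Q
    obtain ⟨a, rfl, ha'⟩ := ha.exists_forest
    obtain ⟨b, rfl, hb'⟩ := hb.exists_forest
    simp only [← ofForest_append, genFun_Av_ofForest]
    exact Forest.avoidGF_append_comm X Y ha' hb'
  | rotate ha hb hc =>
    obtain ⟨a, rfl, ha'⟩ := ha.exists_forest
    obtain ⟨b, rfl, hb'⟩ := hb.exists_forest
    obtain ⟨c, rfl, hc'⟩ := hc.exists_forest
    simp only [← ofForest_append, ← ofForest_tree, genFun_Av_ofForest]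
    exact Forest.avoidGF_rotate ha' hb' hc'

theorem wilfEquivalent_of_genFun_eq {S T : Set ArchSystem} (h : genFun S = genFun T) :
    WilfEquivalent S T := by
  have key (n : ℕ) : Nonempty ({X : S // X.1.size = n} ≃ {Y : T // Y.1.size = n}) := by
    have hn : {X ∈ S | X.size = n}.ncard = {X ∈ T | X.size = n}.ncard := by
      have := congrArg (PowerSeries.coeff n) h
      simpa [genFun] using this
    have : Finite {X // X ∈ {X ∈ S | X.size = n}} :=
      ((finite_size_eq n).subset fun X h => h.2).to_subtype
    have : Finite {X // X ∈ {X ∈ T | X.size = n}} :=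
      ((finite_size_eq n).subset fun X h => h.2).to_subtype
    obtain ⟨e⟩ := (Finite.card_eq (α := {X // X ∈ {X ∈ S | X.size = n}})
      (β := {X // X ∈ {X ∈ T | X.size = n}})).1 hn
    exact ⟨((Equiv.subtypeSubtypeEquivSubtypeInter (· ∈ S) (·.size = n)).trans e).trans
      (Equiv.subtypeSubtypeEquivSubtypeInter (· ∈ T) (·.size = n)).symm⟩
  exact ⟨Equiv.ofFiberEquiv (f := fun X : S => X.1.size) (g := fun Y : T => Y.1.size)
    fun n => (key n).some, Equiv.ofFiberEquiv_map
    (f := fun X : S => X.1.size) (g := fun Y : T => Y.1.size) fun n => (key n).some⟩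

end ArchSystem

theorem mainTheorem1 (A B : ArchSystem) (h : ArchSystem.Sim A B) :
    ArchSystem.WilfEquivalent (ArchSystem.Av A) (ArchSystem.Av B) ∧
      ArchSystem.genFun (ArchSystem.Av A) = ArchSystem.genFun (ArchSystem.Av B) :=
  ⟨ArchSystem.wilfEquivalent_of_genFun_eq h.genFun_eq, h.genFun_eq⟩
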